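/- **Setting.** Let $\mathcal S$ be a measurable state space, $\mathcal A$ a finite action set, $\Phi$ a finite feature set, $m$ the number of tasks and $\gamma\in[0,1)$. For $j\in\{1,\dots,m\}$ let $\xi_j(s,a,\phi;\theta)$, $\theta\in\mathbb R^d$, be real-valued approximators, measurable in $s$, and let $\mathcal R_i:\Phi\to\mathbb R$ be the reward of task $i$. Write $\Theta=(\theta^{(1)},\dots,\theta^{(m)})\in\mathbb R^{md}$, $Q^i_k(x,b;\theta)=\sum_{\phi}\xi_k(x,b,\phi;\theta)\mathcal R_i(\phi)$, and $$S(\Theta,x,i)=\operatorname*{arg\,max}_{(k,b)\in\{1,\dots,m\}\times\mathcal A}Q^i_k(x,b;\theta^{(k)}).$$ Let $p(\cdot\mid s,a)$ be a Markov kernel, shared by the tasks, giving the law of (next state, feature) $(s',\phi')$. *Bellman error.* For each $j$ let $\nu_j$ be a finite measure on $\mathcal S\times\mathcal A\times\mathcal A$ (the stationary weight of the triples $(s,a,a')$: state, action, next action), and put $$E_j(\theta)=\int\sum_{\phi\in\Phi}\Big(\mathbb E_{(s',\phi')\sim p(\cdot\mid s,a)}\big[\mathbb 1\{\phi=\phi'\}+\gamma\,\xi_j(s',a',\phi;\theta)\big]-\xi_j(s,a,\phi;\theta)\Big)^2\,d\nu_j(s,a,a'),\qquad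 E(\Theta)=\sum_{j=1}^mE_j(\theta^{(j)}).$$ *Algorithm (FG-SFRQL).* On a probability space, at step $k$ there are a current task $i_k$, a pair $(s_k,a_k)$, a batch of $N_k\ge1$ transitions $(s'_p,\phi_p)_{p\le N_k}$, and a pair $(c_k,a'_k)\in S(\Theta_k,x_k,i_k)$, where $x_k$ is the state at which generalized policy improvement (GPI) is evaluated (for example the next state or the mean next state); all of these are random and measurable, except that $N_k$ is deterministic. With $$\ell_{j,k}(\theta)=\sum_{\phi}\Big(\tfrac1{N_k}\sum_{p=1}^{N_k}\big[\mathbb 1\{\phi=\phi_p\}+\gamma\,\xi_j(s'_p,a'_k,\phi;\theta)\big]-\xi_j(s_k,a_k,\phi;\theta)\Big)^2,$$ the update vector $\tilde G_k$ has $j$-th block $\nabla\ell_{j,k}(\theta_k^{(j)})$ if $j\in\{i_k,c_k\}$ and $0$ otherwise, and $\Theta_{k+1}=\Theta_k-\alpha_k\tilde G_k$. Let $(\mathcal F_k)$ be a filtration to which $(\Theta_k)$ is adapted. **Theorem (Joint-iterate convergence).** Assume: 1. (Regularity) each $\xi_j$ is bounded and $C^2$ in $\theta$, with bounded first and second derivatives,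 uniformly in $(s,a,\phi,\theta)$; 2. (Ties) for every $(x,i)$ the set $\{\Theta: |S(\Theta,x,i)|>1\}$ has Lebesgue measure zero; 3. (Critical points) the set of $\Theta$ with $0\in\partial E(\Theta)$, where $\partial E$ is Clarke's generalized gradient, is finite; 4. (Stability) $\sup_k\|\Theta_k\|<\infty$ almost surely; 5. (Noise) in the decomposition $\tilde G_k=\nabla E(\Theta_k)+M_{k+1}+\varepsilon_k$ with $M_{k+1}=\tilde G_k-\mathbb E[\tilde G_k\mid\mathcal F_k]$ and $\varepsilon_k=\mathbb E[\tilde G_k\mid\mathcal F_k]-\nabla E(\Theta_k)$, there is a constant $C>0$ with $\mathbb E[\|M_{k+1}\|^2\mid\mathcal F_k]\le C(1+\|\Theta_k\|^2)$ almost surely for all $k$, $\|\varepsilon_k\|\to0$ almost surely, and $\sum_k\alpha_k\mathbb E\|\varepsilon_k\|<\infty$; 6. (Step sizes and visitation) $\alpha_k>0$, $\sum_k\alpha_k=\infty$, $\sum_k\alpha_k^2<\infty$, and almost surely every $j\in\{1,\dots,m\}$ lies in $\{i_k,c_k\}$ for infinitely many $k$. Then almost surely $\Theta_k$ converges to a (possibly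 random) point $\Theta^\ast$ at which $E$ is differentiable and $\nabla E(\Theta^\ast)=0$. -/

import Mathlib

open MeasureTheory ProbabilityTheory Filter Topology

noncomputable section

namespace FGSFRQL

/-- The parameter space `ℝ^d` of one task. -/
abbrev Param (d : ℕ) : Type := EuclideanSpace ℝ (Fin d)

/-- The joint parameter space `ℝ^{md}` with its Euclidean norm; the block of task `j` of `Θ`
is `Θ j`. -/
abbrev JointParam (m d : ℕ) : Type := PiLp 2 (fun _ : Fin m => Param d)

/-- The learning problem: the approximators `ξ_j(s, a, φ; θ)`, the rewards `R_i(φ)` of the tasks,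
the discount factor, and the dynamics, shared by the tasks: `p (s, a)` is the law of the pair
(next state, observed feature). -/
structure Model (S A Φ : Type*) [MeasurableSpace S] [MeasurableSpace A] [MeasurableSpace Φ]
    (m d : ℕ) where
  ξ : Fin m → S → A → Φ → Param d → ℝ
  measurable_ξ : ∀ j a φ θ, Measurable fun s => ξ j s a φ θ
  reward : Fin m → Φ → ℝ
  γ : ℝ
  γ_nonneg : 0 ≤ γ
  γ_lt_one : γ < 1
  p : Kernel (S × A) (S × Φ)
  markov : IsMarkovKernel p

namespace Model

variable {S A Φ : Type*} [MeasurableSpace S] [MeasurableSpace A] [MeasurableSpace Φ]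
  [Fintype Φ] [DecidableEq Φ] {m d : ℕ}

/-- `Q_k(x, b; θ) = ∑_φ ξ_k(x, b, φ; θ) R_i(φ)`, the value of action `b` at `x` under the `k`-th
approximator for the reward of task `i`. -/
def Q (𝓜 : Model S A Φ m d) (i k : Fin m) (x : S) (b : A) (θ : Param d) : ℝ :=
  ∑ φ, 𝓜.ξ k x b φ θ * 𝓜.reward i φ

/-- The set `S(Θ, x, i)` of maximizing pairs (prior policy, action) of generalized policy
improvement at the state `x` for the task `i`. -/
def gpiSet (𝓜 : Model S A Φ m d) (Θ : JointParam m d) (x : S) (i : Fin m) : Set (Fin m × A) :=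
  {q | ∀ r : Fin m × A, 𝓜.Q i r.1 x r.2 (Θ r.1) ≤ 𝓜.Q i q.1 x q.2 (Θ q.1)}

/-- The averaged squared Bellman residual `ℓ_j` of a batch of `N` transitions `(s'_p, φ_p)` that
start in `(s, a)`, with next action `a'`. -/
def batchLoss (𝓜 : Model S A Φ m d) (j : Fin m) (s : S) (a : A) {N : ℕ} (K : Fin N → S × Φ)
    (a' : A) (θ : Param d) : ℝ :=
  ∑ φ, ((1 / (N : ℝ)) * ∑ p, ((if φ = (K p).2 then (1 : ℝ) else 0)
      + 𝓜.γ * 𝓜.ξ j (K p).1 a' φ θ) - 𝓜.ξ j s a φ θ) ^ 2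

/-- The joint stochastic update vector: block `j` is the full gradient of `ℓ_j` at `θ^{(j)}` if `j`
is the current task `i` or the chosen prior `c`, and zero otherwise. -/
def G (𝓜 : Model S A Φ m d) (Θ : JointParam m d) (s : S) (a : A) {N : ℕ} (K : Fin N → S × Φ)
    (i c : Fin m) (a' : A) : JointParam m d :=
  WithLp.toLp 2 fun j =>
    if j = i ∨ j = c then gradient (𝓜.batchLoss j s a K a') (Θ j) else 0

/-- The true squared Bellman residual at `(s, a)` with next action `a'`: the batch average in
`batchLoss` is replaced by the expectation given `(s, a)`. -/
def bellmanLoss (𝓜 : Model S A Φ m d) (j : Fin m) (s : S) (a a' : A) (θ : Param d) : ℝ :=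
  ∑ φ, ((∫ y, ((if φ = y.2 then (1 : ℝ) else 0) + 𝓜.γ * 𝓜.ξ j y.1 a' φ θ) ∂(𝓜.p (s, a)))
      - 𝓜.ξ j s a φ θ) ^ 2

/-- The mean squared Bellman error `E_j` of the `j`-th approximator, weighted by `ν j`, the
(stationary) weight of the triples `(s, a, a')`. It is a function of the block `θ^{(j)}` alone. -/
def blockError (𝓜 : Model S A Φ m d) (ν : Fin m → Measure (S × A × A)) (j : Fin m)
    (θ : Param d) : ℝ :=
  ∫ z, 𝓜.bellmanLoss j z.1 z.2.1 z.2.2 θ ∂(ν j)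

/-- The aggregate Bellman error `E(Θ) = ∑_j E_j(θ^{(j)})`. -/
def aggregateError (𝓜 : Model S A Φ m d) (ν : Fin m → Measure (S × A × A))
    (Θ : JointParam m d) : ℝ :=
  ∑ j, 𝓜.blockError ν j (Θ j)

/-- Every `ξ_j` is bounded and `C²` in its parameter, with first and second derivatives bounded,
uniformly in all the arguments. -/
def Regular (𝓜 : Model S A Φ m d) : Prop :=
  (∀ j s a φ, ContDiff ℝ 2 (𝓜.ξ j s a φ)) ∧
  ∃ B : ℝ, ∀ j s a φ θ, |𝓜.ξ j s a φ θ| ≤ B ∧ ‖fderiv ℝ (𝓜.ξ j s a φ) θ‖ ≤ B ∧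
    ‖iteratedFDeriv ℝ 2 (𝓜.ξ j s a φ) θ‖ ≤ B

/-- For each state and each task the joint parameters with a tie in the improvement step form a
Lebesgue null set. -/
def TiesNull (𝓜 : Model S A Φ m d) : Prop :=
  ∀ (x : S) (i : Fin m), volume {Θ : JointParam m d | 1 < (𝓜.gpiSet Θ x i).ncard} = 0

end Model

/-- Clarke's generalized gradient, for functions on a finite-dimensional space: the convex hull of
the limits of gradients at nearby points of differentiability. -/
def generalizedGradient {X : Type*} [NormedAddCommGroup X] [InnerProductSpace ℝ X]
    [CompleteSpace X] (f : X → ℝ) (x : X) : Set X :=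
  convexHull ℝ {v | ∃ u : ℕ → X, Tendsto u atTop (𝓝 x) ∧ (∀ n, DifferentiableAt ℝ f (u n)) ∧
    Tendsto (fun n => gradient f (u n)) atTop (𝓝 v)}

/-- A run of the algorithm with step sizes `α` on the sample space `Ω`. At step `k`, with current
task `task k` and pivot pair `(s k, a k)`, a batch of `N k` transitions (next state, feature) is
used; `gpi k = (c_k, a'_k)` is a maximizing pair at the state `query k` where the improvement step
is evaluated (the next state, the mean next state, or any other choice); then the blocks of the
task and of the prior `c_k` make a full-gradient step. -/
structure Run {S A Φ : Type*} [MeasurableSpace S] [MeasurableSpace A] [MeasurableSpace Φ]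
    [Fintype Φ] [DecidableEq Φ] {m d : ℕ} (𝓜 : Model S A Φ m d)
    (Ω : Type*) [MeasurableSpace Ω] (α : ℕ → ℝ) where
  N : ℕ → ℕ
  N_pos : ∀ k, 0 < N k
  task : ℕ → Ω → Fin m
  s : ℕ → Ω → S
  a : ℕ → Ω → A
  batch : (k : ℕ) → Ω → Fin (N k) → S × Φ
  query : ℕ → Ω → S
  gpi : ℕ → Ω → Fin m × A
  Θ : ℕ → Ω → JointParam m d
  measurable_task : ∀ k, Measurable (task k)
  measurable_s : ∀ k, Measurable (s k)
  measurable_a : ∀ k, Measurable (a k)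
  measurable_batch : ∀ k, Measurable (batch k)
  measurable_query : ∀ k, Measurable (query k)
  measurable_gpi : ∀ k, Measurable (gpi k)
  gpi_mem : ∀ k ω, gpi k ω ∈ 𝓜.gpiSet (Θ k ω) (query k ω) (task k ω)
  update : ∀ k ω, Θ (k + 1) ω = Θ k ω - α k •
    𝓜.G (Θ k ω) (s k ω) (a k ω) (batch k ω) (task k ω) (gpi k ω).1 (gpi k ω).2

namespace Run

variable {S A Φ : Type*} [MeasurableSpace S] [MeasurableSpace A] [MeasurableSpace Φ]
  [Fintype Φ] [DecidableEq Φ] {m d : ℕ} {𝓜 : Model S A Φ m d}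
  {Ω : Type*} [mΩ : MeasurableSpace Ω] {α : ℕ → ℝ}

/-- The stochastic update vector `G̃_k` of step `k`. -/
def Gtilde (r : Run 𝓜 Ω α) (k : ℕ) (ω : Ω) : JointParam m d :=
  𝓜.G (r.Θ k ω) (r.s k ω) (r.a k ω) (r.batch k ω) (r.task k ω) (r.gpi k ω).1 (r.gpi k ω).2

/-- The noise `M_{k+1} = G̃_k - 𝔼[G̃_k | ℱ_k]`. -/
def noise (r : Run 𝓜 Ω α) (P : Measure Ω) (ℱ : Filtration ℕ mΩ) (k : ℕ) (ω : Ω) :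
    JointParam m d :=
  r.Gtilde k ω - (P[r.Gtilde k | ℱ k]) ω

/-- The bias `ε_k = 𝔼[G̃_k | ℱ_k] - ∇E(Θ_k)`. -/
def bias (r : Run 𝓜 Ω α) (P : Measure Ω) (ℱ : Filtration ℕ mΩ)
    (ν : Fin m → Measure (S × A × A)) (k : ℕ) (ω : Ω) : JointParam m d :=
  (P[r.Gtilde k | ℱ k]) ω - gradient (𝓜.aggregateError ν) (r.Θ k ω)

end Run

end FGSFRQL

end

/-! The regularity of the approximators makes `E` bounded and differentiable, with bounded Lipschitz
gradient, and makes the update vector bounded. The recursion is thus gradient descent on `E`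
perturbed by bounded martingale differences `M` and a bias `ε`.

Since `∑ α_k²` is finite, the series `∑ α_k M_{k+1}` and `∑ α_k ⟪∇E(Θ_k), M_{k+1}⟫` are limits of
L²-bounded martingales, so they converge almost surely; `∑ α_k ‖ε_k‖` is almost surely finite
because its expectation is. The rest is deterministic, path by path. Summing the descent lemma gives
`∑ α_k ‖∇E(Θ_k)‖² < ∞` (`summable_mul_sq_norm_gradient`). On a bounded set, away from the finitely
many critical points, `‖∇E‖` is bounded below. As `∑ α_k = ∞`, the path cannot stay away from them,
and late excursions away from them have arbitrarily small displacement, too small to link two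
distinct critical points (`exists_tendsto_of_finite`). So the path converges to one of them. -/

namespace FGSFRQL

/-! ### Calculus of bounded functions with bounded Lipschitz derivative. -/

/-- `f` is bounded by `B` and differentiable, with derivative bounded by `B` and
`B`-Lipschitz. -/
structure BddC11 {X : Type*} [NormedAddCommGroup X] [NormedSpace ℝ X] (B : ℝ) (f : X → ℝ) :
    Prop where
  differentiable : Differentiable ℝ f
  abs_le : ∀ x, |f x| ≤ B
  norm_fderiv_le : ∀ x, ‖fderiv ℝ f x‖ ≤ B
  norm_fderiv_sub_le : ∀ x y, ‖fderiv ℝ f x - fderiv ℝ f y‖ ≤ B * ‖x - y‖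

namespace BddC11

variable {X Y : Type*} [NormedAddCommGroup X] [NormedSpace ℝ X] [NormedAddCommGroup Y]
  [NormedSpace ℝ Y] {B C : ℝ} {f g : X → ℝ}

theorem nonneg (hf : BddC11 B f) : 0 ≤ B := (abs_nonneg _).trans (hf.abs_le 0)

theorem mono (hf : BddC11 B f) (h : B ≤ C) : BddC11 C f where
  differentiable := hf.differentiable
  abs_le x := (hf.abs_le x).trans h
  norm_fderiv_le x := (hf.norm_fderiv_le x).trans h
  norm_fderiv_sub_le x y := (hf.norm_fderiv_sub_le x y).trans (by gcongr)

theorem const {c : ℝ} (hc : |c| ≤ B) : BddC11 B (fun _ : X => c) where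
  differentiable := differentiable_const c
  abs_le _ := hc
  norm_fderiv_le x := by simpa using (abs_nonneg c).trans hc
  norm_fderiv_sub_le x y := by
    simpa using mul_nonneg ((abs_nonneg c).trans hc) (norm_nonneg (x - y))

theorem add (hf : BddC11 B f) (hg : BddC11 C g) : BddC11 (B + C) (fun x => f x + g x) := by
  have hd : ∀ x, fderiv ℝ (fun x => f x + g x) x = fderiv ℝ f x + fderiv ℝ g x := fun x =>
    fderiv_fun_add (hf.differentiable x) (hg.differentiable x)
  refine ⟨hf.differentiable.add hg.differentiable, fun x => ?_, fun x => ?_, fun x y => ?_⟩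
  · exact (abs_add_le _ _).trans (add_le_add (hf.abs_le x) (hg.abs_le x))
  · rw [hd]
    exact (norm_add_le _ _).trans (add_le_add (hf.norm_fderiv_le x) (hg.norm_fderiv_le x))
  · rw [hd, hd, add_sub_add_comm, add_mul]
    exact (norm_add_le _ _).trans
      (add_le_add (hf.norm_fderiv_sub_le x y) (hg.norm_fderiv_sub_le x y))

theorem const_mul (hf : BddC11 B f) (c : ℝ) : BddC11 (|c| * B) (fun x => c * f x) := by
  have hd : ∀ x, fderiv ℝ (fun x => c * f x) x = c • fderiv ℝ f x := fun x =>
    fderiv_const_mul (hf.differentiable x) c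
  refine ⟨hf.differentiable.const_mul c, fun x => ?_, fun x => ?_, fun x y => ?_⟩
  · rw [abs_mul]
    exact mul_le_mul_of_nonneg_left (hf.abs_le x) (abs_nonneg c)
  · rw [hd, norm_smul, Real.norm_eq_abs]
    exact mul_le_mul_of_nonneg_left (hf.norm_fderiv_le x) (abs_nonneg c)
  · rw [hd, hd, ← smul_sub, norm_smul, Real.norm_eq_abs, mul_assoc]
    exact mul_le_mul_of_nonneg_left (hf.norm_fderiv_sub_le x y) (abs_nonneg c)

theorem sub (hf : BddC11 B f) (hg : BddC11 C g) : BddC11 (B + C) (fun x => f x - g x) := by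
  simpa [sub_eq_add_neg] using hf.add (hg.const_mul (-1))

theorem sum {ι : Type*} (s : Finset ι) {b : ι → ℝ} {F : ι → X → ℝ}
    (hF : ∀ i ∈ s, BddC11 (b i) (F i)) : BddC11 (∑ i ∈ s, b i) (fun x => ∑ i ∈ s, F i x) := by
  classical
  induction s using Finset.induction_on with
  | empty => simpa using const (X := X) (c := 0) (B := 0) (by simp)
  | insert i s hi ih =>
    simp only [Finset.sum_insert hi]
    exact (hF i (Finset.mem_insert_self i s)).add
      (ih fun j hj => hF j (Finset.mem_insert_of_mem hj))

/-- The largest constant is the Lipschitz one: the derivative is `2 f f'`, and each factor is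
bounded by `B` and `B`-Lipschitz, whence `2B² + 2B²`. -/
theorem sq (hf : BddC11 B f) : BddC11 (4 * B ^ 2) (fun x => f x ^ 2) := by
  have hB := hf.nonneg
  have hd : ∀ x, fderiv ℝ (fun x => f x ^ 2) x = (2 * f x) • fderiv ℝ f x := fun x => by
    rw [fderiv_fun_pow 2 (hf.differentiable x)]
    simp
  have hlip : ∀ x y, |f x - f y| ≤ B * ‖x - y‖ := fun x y =>
    convex_univ.norm_image_sub_le_of_norm_fderiv_le (𝕜 := ℝ)
      (fun z _ => hf.differentiable z) (fun z _ => hf.norm_fderiv_le z)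
      (Set.mem_univ y) (Set.mem_univ x)
  refine ⟨hf.differentiable.pow 2, fun x => ?_, fun x => ?_, fun x y => ?_⟩
  · rw [abs_pow]
    nlinarith [pow_le_pow_left₀ (abs_nonneg _) (hf.abs_le x) 2, sq_nonneg B]
  · rw [hd, norm_smul, Real.norm_eq_abs, abs_mul, abs_two]
    nlinarith [mul_le_mul (hf.abs_le x) (hf.norm_fderiv_le x) (norm_nonneg _) hB, sq_nonneg B]
  · have h : (2 * f x) • fderiv ℝ f x - (2 * f y) • fderiv ℝ f y
        = (2 * f x) • (fderiv ℝ f x - fderiv ℝ f y) + (2 * (f x - f y)) • fderiv ℝ f y := by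
      module
    rw [hd, hd, h]
    calc _ ≤ 2 * |f x| * ‖fderiv ℝ f x - fderiv ℝ f y‖ + 2 * |f x - f y| * ‖fderiv ℝ f y‖ := by
          refine (norm_add_le _ _).trans (le_of_eq ?_)
          simp [norm_smul]
      _ ≤ 2 * B * (B * ‖x - y‖) + 2 * (B * ‖x - y‖) * B := by
          gcongr
          exacts [hf.abs_le x, hf.norm_fderiv_sub_le x y, hlip x y, hf.norm_fderiv_le y]
      _ = _ := by ring

theorem comp_clm (hf : BddC11 B f) (L : Y →L[ℝ] X) (hL : ‖L‖ ≤ 1) :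
    BddC11 B (fun y => f (L y)) := by
  have hB := hf.nonneg
  have hd : ∀ y, fderiv ℝ (fun y => f (L y)) y = (fderiv ℝ f (L y)).comp L := fun y =>
    ((hf.differentiable (L y)).hasFDerivAt.comp y L.hasFDerivAt).fderiv
  have hc : ∀ A : X →L[ℝ] ℝ, ‖A.comp L‖ ≤ ‖A‖ := fun A =>
    (A.opNorm_comp_le L).trans (mul_le_of_le_one_right (norm_nonneg _) hL)
  refine ⟨hf.differentiable.comp L.differentiable, fun y => hf.abs_le _, fun y => ?_,
    fun y z => ?_⟩
  · rw [hd]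
    exact (hc _).trans (hf.norm_fderiv_le _)
  · rw [hd, hd, ← ContinuousLinearMap.sub_comp]
    refine (hc _).trans ((hf.norm_fderiv_sub_le _ _).trans ?_)
    rw [← map_sub]
    have := (L.le_opNorm (y - z)).trans (mul_le_of_le_one_left (norm_nonneg _) hL)
    gcongr

/-- The derivative of a parametrized function is measurable in the parameter if the values are. -/
theorem measurable_fderiv_param [FiniteDimensional ℝ X] {T : Type*} [MeasurableSpace T]
    {F : T → X → ℝ} (hd : ∀ t, Differentiable ℝ (F t)) (hF : ∀ x, Measurable fun t => F t x)
    (x : X) : StronglyMeasurable fun t => fderiv ℝ (F t) x := by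
  -- Directional derivatives are limits of difference quotients, which are measurable in `t`;
  -- finitely many directions then determine the whole derivative.
  have hv : ∀ v : X, Measurable fun t => fderiv ℝ (F t) x v := fun v => by
    refine measurable_of_tendsto_metrizable
      (f := fun (n : ℕ) t => ((n : ℝ) + 1) * (F t (x + ((n : ℝ) + 1)⁻¹ • v) - F t x))
      (fun n => ((hF _).sub (hF _)).const_mul _) (tendsto_pi_nhds.2 fun t => ?_)
    have h1 : Tendsto (fun n : ℕ => ‖(n : ℝ) + 1‖) atTop atTop :=
      tendsto_norm_atTop_atTop.comp (tendsto_natCast_atTop_atTop.atTop_add tendsto_const_nhds)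
    exact ((hd t x).hasFDerivAt.lim v h1)
  let b := Module.finBasis ℝ X
  have hsum : (fun t => fderiv ℝ (F t) x) = fun t => ∑ i, fderiv ℝ (F t) x (b i) •
      (LinearMap.toContinuousLinearMap (b.coord i) : X →L[ℝ] ℝ) := by
    ext t v
    have h := congrArg (fderiv ℝ (F t) x) (b.sum_repr v)
    simp only [map_sum, map_smul, smul_eq_mul] at h
    simp [← h, mul_comm]
  rw [hsum]
  exact Finset.stronglyMeasurable_fun_sum _ fun i _ =>
    (hv (b i)).stronglyMeasurable.smul_const _

/-- Differentiation under the integral sign, dominated by the constant `B`, which is integrable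
because the measure is finite. It serves both the transition kernel and the weights `ν j`. -/
theorem integral [FiniteDimensional ℝ X] {T : Type*} [MeasurableSpace T] (μ : Measure T)
    [IsFiniteMeasure μ] {F : T → X → ℝ} (hF : ∀ t, BddC11 B (F t))
    (hm : ∀ x, Measurable fun t => F t x) :
    BddC11 (B * μ.real Set.univ) (fun x => ∫ t, F t x ∂μ) := by
  have hd' : ∀ x, HasFDerivAt (fun x => ∫ t, F t x ∂μ) (∫ t, fderiv ℝ (F t) x ∂μ) x := fun x =>
    hasFDerivAt_integral_of_dominated_of_fderiv_le (F := fun x t => F t x)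
      (F' := fun x t => fderiv ℝ (F t) x) (bound := fun _ => B) univ_mem
      (Eventually.of_forall fun y => (hm y).aestronglyMeasurable)
      (Integrable.of_bound (hm x).aestronglyMeasurable B
        (ae_of_all _ fun t => (hF t).abs_le x))
      (measurable_fderiv_param (fun t => (hF t).differentiable) hm x).aestronglyMeasurable
      (ae_of_all _ fun t y _ => (hF t).norm_fderiv_le y) (integrable_const B)
      (ae_of_all _ fun t y _ => ((hF t).differentiable y).hasFDerivAt)
  have hi : ∀ x, Integrable (fun t => fderiv ℝ (F t) x) μ := fun x =>
    Integrable.of_bound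
      (measurable_fderiv_param (fun t => (hF t).differentiable) hm x).aestronglyMeasurable B
      (ae_of_all _ fun t => (hF t).norm_fderiv_le x)
  refine ⟨fun x => (hd' x).differentiableAt, fun x => ?_, fun x => ?_, fun x y => ?_⟩
  · rw [← Real.norm_eq_abs]
    exact norm_integral_le_of_norm_le_const (ae_of_all _ fun t => (hF t).abs_le x)
  · rw [(hd' x).fderiv]
    exact norm_integral_le_of_norm_le_const (ae_of_all _ fun t => (hF t).norm_fderiv_le x)
  · rw [(hd' x).fderiv, (hd' y).fderiv, ← integral_sub (hi x) (hi y), mul_right_comm]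
    exact norm_integral_le_of_norm_le_const
      (ae_of_all _ fun t => (hF t).norm_fderiv_sub_le x y)

theorem of_contDiff_two (hf : ContDiff ℝ 2 f) (h0 : ∀ x, |f x| ≤ B)
    (h1 : ∀ x, ‖fderiv ℝ f x‖ ≤ B) (h2 : ∀ x, ‖iteratedFDeriv ℝ 2 f x‖ ≤ B) : BddC11 B f := by
  refine ⟨hf.differentiable (by norm_num), h0, h1, fun x y => ?_⟩
  have hc : ContDiff ℝ 1 (fderiv ℝ f) := hf.fderiv_right (by norm_num)
  refine convex_univ.norm_image_sub_le_of_norm_fderiv_le (𝕜 := ℝ)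
    (fun z _ => hc.differentiable (by norm_num) z) (fun z _ => ?_)
    (Set.mem_univ y) (Set.mem_univ x)
  have h := h2 z
  rwa [← norm_iteratedFDeriv_fderiv, ← norm_iteratedFDeriv_fderiv,
    norm_iteratedFDeriv_zero] at h

end BddC11

/-! ### Gradients and the descent lemma. -/

section Gradient

variable {X : Type*} [NormedAddCommGroup X] [InnerProductSpace ℝ X] [CompleteSpace X] {B : ℝ}
  {f : X → ℝ}

theorem BddC11.norm_gradient_le (hf : BddC11 B f) (x : X) : ‖gradient f x‖ ≤ B := by
  simpa [gradient] using hf.norm_fderiv_le x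

theorem BddC11.continuous_gradient (hf : BddC11 B f) : Continuous (gradient f) := by
  have : Continuous (fderiv ℝ f) :=
    (LipschitzWith.of_dist_le_mul (K := B.toNNReal) fun x y => by
      simpa [dist_eq_norm, Real.coe_toNNReal _ hf.nonneg] using
        hf.norm_fderiv_sub_le x y).continuous
  exact (InnerProductSpace.toDual ℝ X).symm.continuous.comp this

/-- The descent lemma. -/
theorem BddC11.le_add_inner_gradient (hf : BddC11 B f) (x y : X) :
    f y ≤ f x + inner ℝ (gradient f x) (y - x) + B * ‖y - x‖ ^ 2 := by
  -- On the ball of radius `‖y - x‖` about `x` the derivative varies by at most `B * ‖y - x‖`. The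
  -- mean value inequality then gives the constant `B` instead of the sharp `B / 2`, which is
  -- enough.
  have h := (convex_closedBall x ‖y - x‖).norm_image_sub_le_of_norm_fderiv_le' (𝕜 := ℝ)
    (f := f) (φ := fderiv ℝ f x) (C := B * ‖y - x‖) (x := x) (y := y)
    (fun z _ => hf.differentiable z)
    (fun z hz => (hf.norm_fderiv_sub_le z x).trans
      (mul_le_mul_of_nonneg_left (mem_closedBall_iff_norm.1 hz) hf.nonneg))
    (by simp) (by simp [dist_eq_norm])
  have hi : inner ℝ (gradient f x) (y - x) = fderiv ℝ f x (y - x) := by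
    simp [gradient]
  have := (le_abs_self _).trans h
  rw [hi]
  nlinarith

end Gradient


/-! ### Deterministic convergence to a point of a finite set. -/

/-- A sequence with vanishing steps that keeps returning to every neighbourhood of a finite set,
and moves arbitrarily little on late stretches away from it, converges to a point of the set. -/
theorem exists_tendsto_of_finite {X : Type*} [MetricSpace X] {x : ℕ → X} {Z : Set X}
    (hZ : Z.Finite)
    (hret : ∀ δ > 0, ∃ᶠ k in atTop, ∃ z ∈ Z, dist (x k) z < δ)
    (hmove : ∀ δ > 0, ∀ η > 0, ∃ N, ∀ n ≥ N, ∀ m ≥ n,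
      (∀ k, n ≤ k → k < m → ∀ z ∈ Z, δ ≤ dist (x k) z) → dist (x m) (x n) ≤ η)
    (hstep : Tendsto (fun k => dist (x (k + 1)) (x k)) atTop (𝓝 0)) :
    ∃ z ∈ Z, Tendsto x atTop (𝓝 z) := by
  -- Pigeonhole: if each point of `Z` were eventually avoided at some radius, one small radius would
  -- do for all of them, against `hret`.
  obtain ⟨z, hz, hzfreq⟩ : ∃ z ∈ Z, ∀ δ > 0, ∃ᶠ k in atTop, dist (x k) z < δ := by
    by_contra! h
    have h' : ∀ z ∈ Z, ∀ᶠ δ in 𝓝[>] (0 : ℝ), ∀ᶠ k in atTop, δ ≤ dist (x k) z := by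
      intro z hz
      obtain ⟨δ, hδ, hk⟩ := h z hz
      filter_upwards [Ioo_mem_nhdsGT hδ] with δ' hδ'
      exact hk.mono fun k hk => hδ'.2.le.trans hk
    obtain ⟨δ, hδ, hδ0⟩ := (((eventually_all_finite hZ).2 h').and self_mem_nhdsWithin).exists
    refine hret δ hδ0 (((eventually_all_finite hZ).2 hδ).mono fun k hk => ?_)
    rintro ⟨z, hz, hlt⟩
    exact (hk z hz).not_gt hlt
  refine ⟨z, hz, Metric.tendsto_atTop.2 fun ε hε => ?_⟩
  -- With points of `Z` at distance at least `4δ` from `z`, anything within `2δ` of `z` but not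
  -- within `δ` is `δ`-far from all of `Z`, so `hmove` applies.
  obtain ⟨δ, ⟨hδ, hδε⟩, hδ0⟩ : ∃ δ : ℝ, ((∀ z' ∈ Z, z' ≠ z → 4 * δ ≤ dist z z') ∧ 2 * δ ≤ ε) ∧
      0 < δ := by
    have h1 : ∀ z' ∈ Z, ∀ᶠ δ in 𝓝[>] (0 : ℝ), z' ≠ z → 4 * δ ≤ dist z z' := by
      intro z' _
      by_cases hne : z' = z
      · simp [hne]
      · filter_upwards [Ioo_mem_nhdsGT (div_pos (dist_pos.2 (Ne.symm hne)) four_pos)] with δ hδ _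
        have := hδ.2
        linarith
    have h2 : ∀ᶠ δ in 𝓝[>] (0 : ℝ), 2 * δ ≤ ε := by
      filter_upwards [Ioo_mem_nhdsGT (half_pos hε)] with δ hδ
      have := hδ.2
      linarith
    exact ((((eventually_all_finite hZ).2 h1).and h2).and self_mem_nhdsWithin).exists
  obtain ⟨N₁, hN₁⟩ := hmove δ hδ0 (δ / 4) (by positivity)
  obtain ⟨N₂, hN₂⟩ := eventually_atTop.1 (hstep.eventually_lt_const (half_pos hδ0))
  obtain ⟨k₀, hk₀, hk₀z⟩ := frequently_atTop.1 (hzfreq δ hδ0) (max N₁ N₂)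
  -- In the second case `n` is the time just after leaving the `δ`-ball. The exit step is shorter
  -- than `δ/2`, hence `3δ/2`; the excursion adds at most `δ/4`, so the path stays within `2δ ≤ ε`.
  have hinv : ∀ k ≥ k₀, dist (x k) z < δ ∨ ∃ n, k₀ ≤ n ∧ n ≤ k ∧ dist (x n) z < 3 * δ / 2 ∧
      ∀ l, n ≤ l → l < k → ∀ z' ∈ Z, δ ≤ dist (x l) z' := by
    have hclose : ∀ k, (∃ n, k₀ ≤ n ∧ n ≤ k ∧ dist (x n) z < 3 * δ / 2 ∧
        ∀ l, n ≤ l → l < k → ∀ z' ∈ Z, δ ≤ dist (x l) z') → dist (x k) z < 2 * δ := by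
      rintro k ⟨n, hn, hnk, hd, hl⟩
      have := hN₁ n ((le_max_left _ _).trans (hk₀.trans hn)) k hnk hl
      linarith [dist_triangle (x k) (x n) z]
    intro k hk
    induction k, hk using Nat.le_induction with
    | base => exact Or.inl hk₀z
    | succ k hk ih =>
      refine Or.inr ?_
      by_cases hlt : dist (x k) z < δ
      · refine ⟨k + 1, by omega, le_rfl, ?_, fun l h1 h2 => absurd h1 (by omega)⟩
        have := hN₂ k ((le_max_right _ _).trans (hk₀.trans hk))
        linarith [dist_triangle (x (k + 1)) (x k) z]
      · obtain hex := ih.resolve_left hlt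
        have hk2 := hclose k hex
        obtain ⟨n, hn, hnk, hd, hl⟩ := hex
        refine ⟨n, hn, by omega, hd, fun l h1 h2 z' hz' => ?_⟩
        rcases (Nat.lt_succ_iff_lt_or_eq.1 h2) with h2 | rfl
        · exact hl l h1 h2 z' hz'
        · by_cases hne : z' = z
          · exact hne ▸ not_lt.1 hlt
          · have := hδ z' hz' hne
            linarith [dist_triangle z (x l) z', dist_comm z (x l)]
  refine ⟨k₀, fun k hk => ?_⟩
  rcases hinv k hk with h | ⟨n, hn, hnk, hd, hl⟩
  · linarith
  · have := hN₁ n ((le_max_left _ _).trans (hk₀.trans hn)) k hnk hl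
    linarith [dist_triangle (x k) (x n) z]

/-! ### Deterministic perturbed gradient descent. -/

section

variable {X : Type*} [NormedAddCommGroup X] [InnerProductSpace ℝ X] [CompleteSpace X] {K C : ℝ}
  {f : X → ℝ} {x u M e : ℕ → X} {α : ℕ → ℝ}

/-- Sum the descent inequality: the values of `f` telescope to at most `2 * K`, the noise cross
terms have bounded partial sums because these converge, the bias costs at most `K * ∑ α_k ‖e k‖`,
and the quadratic remainder at most `K * C ^ 2 * ∑ α_k²`. -/
theorem summable_mul_sq_norm_gradient (hf : BddC11 K f) (hu : ∀ k, ‖u k‖ ≤ C)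
    (hx : ∀ k, x (k + 1) = x k - α k • u k) (hdec : ∀ k, u k = gradient f (x k) + M k + e k)
    (hα : ∀ k, 0 < α k) (hα_sq : Summable fun k => α k ^ 2)
    (hMi : ∃ c, Tendsto (fun n => ∑ k ∈ Finset.range n, α k * inner ℝ (gradient f (x k)) (M k))
      atTop (𝓝 c))
    (he : Summable fun k => α k * ‖e k‖) :
    Summable fun k => α k * ‖gradient f (x k)‖ ^ 2 := by
  have hK := hf.nonneg
  obtain ⟨c, hc⟩ := hMi
  obtain ⟨D, hD⟩ := (Metric.isBounded_range_of_tendsto _ hc).exists_norm_le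
  have hdescent : ∀ k, α k * ‖gradient f (x k)‖ ^ 2 ≤ (f (x k) - f (x (k + 1)))
      - α k * inner ℝ (gradient f (x k)) (M k) + K * (α k * ‖e k‖) + K * C ^ 2 * α k ^ 2 := by
    intro k
    have h := hf.le_add_inner_gradient (x k) (x (k + 1))
    have hxs : x (k + 1) - x k = -(α k • u k) := by rw [hx]; abel
    have hn : ‖x (k + 1) - x k‖ ^ 2 ≤ C ^ 2 * α k ^ 2 := by
      rw [hxs, norm_neg, norm_smul, mul_pow, Real.norm_eq_abs, sq_abs, mul_comm]
      gcongr
      exact hu k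
    have hin : inner ℝ (gradient f (x k)) (x (k + 1) - x k) = -(α k * ‖gradient f (x k)‖ ^ 2
        + α k * inner ℝ (gradient f (x k)) (M k) + α k * inner ℝ (gradient f (x k)) (e k)) := by
      rw [hxs, inner_neg_right, real_inner_smul_right, hdec, inner_add_right, inner_add_right,
        real_inner_self_eq_norm_sq]
      ring
    have hie : -(α k * inner ℝ (gradient f (x k)) (e k)) ≤ K * (α k * ‖e k‖) := by
      have h1 := (abs_real_inner_le_norm (gradient f (x k)) (e k)).trans
        (mul_le_mul_of_nonneg_right (hf.norm_gradient_le (x k)) (norm_nonneg (e k)))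
      have h2 := neg_le_of_abs_le h1
      nlinarith [hα k]
    have := mul_le_mul_of_nonneg_left hn hK
    linarith
  refine summable_of_sum_range_le
    (c := 2 * K + D + K * ∑' k, α k * ‖e k‖ + K * C ^ 2 * ∑' k, α k ^ 2)
    (fun k => mul_nonneg (hα k).le (sq_nonneg _)) fun n => ?_
  calc _ ≤ ∑ k ∈ Finset.range n, ((f (x k) - f (x (k + 1)))
      - α k * inner ℝ (gradient f (x k)) (M k) + K * (α k * ‖e k‖) + K * C ^ 2 * α k ^ 2) :=
        Finset.sum_le_sum fun k _ => hdescent k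
    _ = (f (x 0) - f (x n)) - ∑ k ∈ Finset.range n, α k * inner ℝ (gradient f (x k)) (M k)
        + K * ∑ k ∈ Finset.range n, α k * ‖e k‖
        + K * C ^ 2 * ∑ k ∈ Finset.range n, α k ^ 2 := by
        rw [Finset.sum_add_distrib, Finset.sum_add_distrib, Finset.sum_sub_distrib,
          Finset.sum_range_sub', Finset.mul_sum, Finset.mul_sum]
    _ ≤ _ := by
        have h1 := abs_le.1 (hf.abs_le (x 0))
        have h2 := abs_le.1 (hf.abs_le (x n))
        have h3 := abs_le.1 (hD _ ⟨n, rfl⟩)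
        have h4 := he.sum_le_tsum (Finset.range n)
          fun k _ => mul_nonneg (hα k).le (norm_nonneg _)
        have h5 := hα_sq.sum_le_tsum (Finset.range n) fun k _ => sq_nonneg _
        have h4' := mul_le_mul_of_nonneg_left h4 hK
        have h5' := mul_le_mul_of_nonneg_left h5 (mul_nonneg hK (sq_nonneg C))
        linarith [h1.2, h2.1, h3.1]

/-- Perturbed gradient descent with finitely many critical points: a bounded trajectory converges
to a critical point. -/
theorem exists_tendsto_of_perturbed_gradient [FiniteDimensional ℝ X] (hf : BddC11 K f)
    (hcrit : {z | gradient f z = 0}.Finite) (hu : ∀ k, ‖u k‖ ≤ C)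
    (hx : ∀ k, x (k + 1) = x k - α k • u k) (hdec : ∀ k, u k = gradient f (x k) + M k + e k)
    {R : ℝ} (hR : ∀ k, ‖x k‖ ≤ R)
    (hα : ∀ k, 0 < α k) (hα_sum : ¬ Summable α) (hα_sq : Summable fun k => α k ^ 2)
    (hM : ∃ c, Tendsto (fun n => ∑ k ∈ Finset.range n, α k • M k) atTop (𝓝 c))
    (hMi : ∃ c, Tendsto (fun n => ∑ k ∈ Finset.range n, α k * inner ℝ (gradient f (x k)) (M k))
      atTop (𝓝 c))
    (he : Summable fun k => α k * ‖e k‖) :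
    ∃ z, gradient f z = 0 ∧ Tendsto x atTop (𝓝 z) := by
  have hsum := summable_mul_sq_norm_gradient hf hu hx hdec hα hα_sq hMi he
  have hα0 : Tendsto α atTop (𝓝 0) := by
    have h := hα_sq.tendsto_atTop_zero.sqrt
    simpa [Real.sqrt_sq (hα _).le] using h
  -- Compactness: the closed ball of radius `R` without the open `δ`-balls about critical points is
  -- compact, and the continuous function `‖∇f‖` has no zero there.
  have haway : ∀ δ > 0, ∃ c > 0, ∀ k, (∀ z ∈ {z | gradient f z = 0}, δ ≤ dist (x k) z) →
      c ≤ ‖gradient f (x k)‖ := by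
    intro δ hδ
    have hcomp : IsCompact (Metric.closedBall (0 : X) R ∩
        ⋂ z ∈ {z | gradient f z = 0}, {y | δ ≤ dist y z}) :=
      (isCompact_closedBall 0 R).inter_right (isClosed_biInter fun z _ =>
        isClosed_le continuous_const (continuous_id.dist continuous_const))
    obtain ⟨c, hc, hcle⟩ := hcomp.exists_forall_le' (f := fun y => ‖gradient f y‖) (a := 0)
      hf.continuous_gradient.norm.continuousOn fun y hy => by
        refine norm_pos_iff.2 fun h0 => ?_
        have := Set.mem_iInter₂.1 hy.2 y h0
        simp only [Set.mem_ofPred_eq, dist_self] at this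
        linarith
    exact ⟨c, hc, fun k hk => hcle _ ⟨by simpa using hR k, Set.mem_iInter₂.2 hk⟩⟩
  refine exists_tendsto_of_finite (x := x) hcrit ?_ ?_ ?_
  -- Staying away forever would give `c² α_k ≤ α_k ‖∇f(x_k)‖²` for late `k`, making `α` summable.
  · intro δ hδ hev
    obtain ⟨c, hc, hcle⟩ := haway δ hδ
    obtain ⟨N, hN⟩ := eventually_atTop.1 hev
    refine hα_sum ((summable_nat_add_iff N).1 ?_)
    refine Summable.of_nonneg_of_le (fun k => (hα _).le) (fun k => ?_)
      (((summable_nat_add_iff N).2 hsum).mul_left (1 / c ^ 2))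
    have h := hcle (k + N) fun z hz => not_lt.1 fun hlt => hN (k + N) (by omega) ⟨z, hz, hlt⟩
    have h2 : c ^ 2 ≤ ‖gradient f (x (k + N))‖ ^ 2 := by gcongr
    rw [one_div, inv_mul_eq_div, le_div_iff₀ (by positivity)]
    exact mul_le_mul_of_nonneg_left h2 (hα _).le
  · intro δ hδ η hη
    obtain ⟨c, hc, hcle⟩ := haway δ hδ
    obtain ⟨cM, hcM⟩ := hM
    have hS1 := hsum.hasSum.tendsto_sum_nat.cauchySeq
    have hS2 := he.hasSum.tendsto_sum_nat.cauchySeq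
    -- The tolerance carries a factor `c` because `c ∑ α_k ‖∇f‖ ≤ ∑ α_k ‖∇f‖²` on stretches away
    -- from critical points. Gradient, noise and bias each contribute at most `η / 3` to the
    -- displacement.
    obtain ⟨N₁, hN₁⟩ := Metric.cauchySeq_iff.1 hS1 (c * (η / 3)) (by positivity)
    obtain ⟨N₂, hN₂⟩ := Metric.cauchySeq_iff.1 hS2 (η / 3) (by positivity)
    obtain ⟨N₃, hN₃⟩ := Metric.cauchySeq_iff.1 hcM.cauchySeq (η / 3) (by positivity)
    refine ⟨max N₁ (max N₂ N₃), fun n hn m hm hk => ?_⟩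
    have hn1 : N₁ ≤ n := (le_max_left _ _).trans hn
    have hn2 : N₂ ≤ n := (le_max_left _ _).trans ((le_max_right _ _).trans hn)
    have hn3 : N₃ ≤ n := (le_max_right _ _).trans ((le_max_right _ _).trans hn)
    have h1 := hN₁ m (hn1.trans hm) n hn1
    have h2 := hN₂ m (hn2.trans hm) n hn2
    have h3 := hN₃ m (hn3.trans hm) n hn3
    rw [dist_eq_norm, ← Finset.sum_Ico_eq_sub _ hm] at h1 h2 h3
    have hxmn : x m - x n = -(∑ k ∈ Finset.Ico n m, α k • gradient f (x k)
        + ∑ k ∈ Finset.Ico n m, α k • M k + ∑ k ∈ Finset.Ico n m, α k • e k) := by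
      rw [← Finset.sum_Ico_sub _ hm, ← Finset.sum_add_distrib, ← Finset.sum_add_distrib,
        ← Finset.sum_neg_distrib]
      refine Finset.sum_congr rfl fun k _ => ?_
      rw [hx, hdec]
      module
    have hg : ‖∑ k ∈ Finset.Ico n m, α k • gradient f (x k)‖ ≤ η / 3 := by
      refine le_of_mul_le_mul_left ?_ hc
      refine le_trans ?_ ((Real.le_norm_self _).trans h1.le)
      refine (mul_le_mul_of_nonneg_left (norm_sum_le _ _) hc.le).trans ?_
      rw [Finset.mul_sum]
      refine Finset.sum_le_sum fun k hkm => ?_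
      have hck := hcle k (hk k (Finset.mem_Ico.1 hkm).1 (Finset.mem_Ico.1 hkm).2)
      rw [norm_smul, Real.norm_of_nonneg (hα k).le]
      nlinarith [mul_le_mul_of_nonneg_left
        (mul_le_mul_of_nonneg_right hck (norm_nonneg (gradient f (x k)))) (hα k).le]
    have hen : ‖∑ k ∈ Finset.Ico n m, α k • e k‖ ≤ η / 3 := by
      refine le_trans ?_ ((Real.le_norm_self _).trans h2.le)
      refine (norm_sum_le _ _).trans (Finset.sum_le_sum fun k _ => ?_)
      rw [norm_smul, Real.norm_of_nonneg (hα k).le]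
    rw [dist_eq_norm, hxmn, norm_neg]
    refine (norm_add₃_le).trans ?_
    linarith
  · refine squeeze_zero (fun _ => dist_nonneg) (fun k => ?_) (by simpa using hα0.mul_const C)
    rw [dist_eq_norm, hx, sub_sub_cancel_left, norm_neg, norm_smul,
      Real.norm_of_nonneg (hα k).le]
    exact mul_le_mul_of_nonneg_left (hu k) (hα k).le

end

/-! ### Almost sure convergence of the weighted bias and noise series. -/

section

/-- By Tonelli the sum has finite expectation, hence is almost surely finite. -/
theorem ae_summable_of_summable_integral {Ω : Type*} {mΩ : MeasurableSpace Ω} {P : Measure Ω}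
    {F : ℕ → Ω → ℝ} (hF : ∀ k, Integrable (F k) P) (h0 : ∀ k ω, 0 ≤ F k ω)
    (hs : Summable fun k => ∫ ω, F k ω ∂P) : ∀ᵐ ω ∂P, Summable fun k => F k ω := by
  have hlin : ∀ k, ∫⁻ ω, ENNReal.ofReal (F k ω) ∂P = ENNReal.ofReal (∫ ω, F k ω ∂P) := fun k =>
    (ofReal_integral_eq_lintegral_ofReal (hF k) (ae_of_all _ (h0 k))).symm
  have hfin : ∫⁻ ω, ∑' k, ENNReal.ofReal (F k ω) ∂P ≠ ⊤ := by
    rw [lintegral_tsum fun k => (hF k).aemeasurable.ennreal_ofReal]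
    simp_rw [hlin]
    exact hs.tsum_ofReal_ne_top
  filter_upwards [ae_lt_top' (AEMeasurable.tsum fun k =>
    (hF k).aemeasurable.ennreal_ofReal) hfin] with ω hω
  have h := ENNReal.summable_toReal hω.ne
  simpa [ENNReal.toReal_ofReal (h0 _ ω)] using h

variable {Ω : Type*} {mΩ : MeasurableSpace Ω} {P : Measure Ω} [IsProbabilityMeasure P]
  {ℱ : Filtration ℕ mΩ} {α : ℕ → ℝ}

/-- The centred sums of a bounded adapted sequence, with square summable weights, converge. -/
theorem ae_exists_tendsto_sum_mul_sub_condExp {Y : ℕ → Ω → ℝ} {K : ℝ}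
    (hY : ∀ k, StronglyMeasurable[ℱ (k + 1)] (Y k)) (hK : ∀ k, ∀ᵐ ω ∂P, |Y k ω| ≤ K)
    (hα : Summable fun k => α k ^ 2) :
    ∀ᵐ ω ∂P, ∃ c, Tendsto
      (fun n => ∑ k ∈ Finset.range n, α k * (Y k ω - (P[Y k | ℱ k]) ω)) atTop (𝓝 c) := by
  set X : ℕ → Ω → ℝ := fun k ω => Y k ω - (P[Y k | ℱ k]) ω with hXdef
  have hXm : ∀ k, StronglyMeasurable[ℱ (k + 1)] (X k) := fun k =>
    (hY k).sub (stronglyMeasurable_condExp.mono (ℱ.mono k.le_succ))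
  have hXb : ∀ k, ∀ᵐ ω ∂P, ‖X k ω‖ ≤ 2 * K := fun k => by
    filter_upwards [hK k, ae_bdd_abs_condExp_of_ae_bdd_abs (m := ℱ k) (hK k)] with ω h1 h2
    refine (norm_sub_le _ _).trans ?_
    simp only [Real.norm_eq_abs] at *
    linarith
  have hXL : ∀ k, MemLp (X k) 2 P := fun k =>
    MemLp.of_bound ((hXm k).mono (ℱ.le _)).aestronglyMeasurable _ (hXb k)
  have hYi : ∀ k, Integrable (Y k) P := fun k =>
    Integrable.of_bound ((hY k).mono (ℱ.le _)).aestronglyMeasurable K (hK k)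
  have hXc : ∀ k, P[X k | ℱ k] =ᵐ[P] 0 := fun k => by
    have h1 := condExp_sub (hYi k) (integrable_condExp (f := Y k) (m := ℱ k) (μ := P)) (ℱ k)
    rw [condExp_of_stronglyMeasurable (ℱ.le k) stronglyMeasurable_condExp
      integrable_condExp] at h1
    rw [sub_self] at h1
    exact h1
  set Sn : ℕ → Ω → ℝ := fun n ω => ∑ k ∈ Finset.range n, α k * X k ω with hSdef
  have hSm : ∀ n, StronglyMeasurable[ℱ n] (Sn n) := fun n =>
    Finset.stronglyMeasurable_fun_sum _ fun k hk =>
      ((hXm k).mono (ℱ.mono (Finset.mem_range.1 hk))).const_mul (α k)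
  have hSL : ∀ n, MemLp (Sn n) 2 P := fun n =>
    memLp_finsetSum _ fun k _ => (hXL k).const_mul (α k)
  have hSsucc : ∀ n ω, Sn (n + 1) ω = Sn n ω + α n * X n ω := fun n ω =>
    Finset.sum_range_succ _ _
  have hmart : Martingale Sn ℱ P := by
    refine martingale_of_condExp_sub_eq_zero_nat hSm
      (fun n => (hSL n).integrable one_le_two) fun n => ?_
    have : Sn (n + 1) - Sn n = α n • X n := by
      ext ω
      simp [hSsucc]
    rw [this]
    refine (condExp_smul (α n) (X n) (ℱ n)).trans ?_
    filter_upwards [hXc n] with ω hω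
    simp [hω]
  -- `Sn n` is known at time `n` and `X n` has zero conditional mean, so the cross terms vanish and
  -- the second moments of the increments add up.
  have horth : ∀ n, ∫ ω, Sn n ω * X n ω ∂P = 0 := fun n => by
    have hi : Integrable (Sn n * X n) P := (hSL n).integrable_mul (hXL n)
    have h1 := condExp_mul_of_stronglyMeasurable_left (hSm n) hi
      ((hXL n).integrable one_le_two)
    have h2 := integral_condExp (μ := P) (f := Sn n * X n) (ℱ.le n)
    have h3 : P[Sn n * X n | ℱ n] =ᵐ[P] 0 := by
      filter_upwards [h1, hXc n] with ω h1 h2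
      simp [h1, h2]
    rw [integral_congr_ae h3] at h2
    simpa using h2.symm
  have hsq : ∀ n, ∫ ω, Sn n ω ^ 2 ∂P ≤ ∑ k ∈ Finset.range n, α k ^ 2 * (2 * K) ^ 2 := by
    intro n
    induction n with
    | zero => simp [hSdef]
    | succ n ih =>
      have hX2 : ∫ ω, X n ω ^ 2 ∂P ≤ (2 * K) ^ 2 := by
        have h := integral_mono_ae (hXL n).integrable_sq (integrable_const ((2 * K) ^ 2))
          ((hXb n).mono fun ω hω => sq_le_sq' (neg_le_of_abs_le hω) (le_of_abs_le hω))
        simpa using h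
      have hexp : ∀ ω, Sn (n + 1) ω ^ 2
          = Sn n ω ^ 2 + (2 * α n) * (Sn n ω * X n ω) + α n ^ 2 * X n ω ^ 2 := fun ω => by
        rw [hSsucc]
        ring
      have hi : Integrable (fun ω => Sn n ω * X n ω) P := (hSL n).integrable_mul (hXL n)
      have hi' : Integrable (fun ω => Sn n ω ^ 2 + (2 * α n) * (Sn n ω * X n ω)) P :=
        (hSL n).integrable_sq.add (hi.const_mul _)
      simp_rw [hexp]
      rw [integral_add hi' ((hXL n).integrable_sq.const_mul _),
        integral_add (hSL n).integrable_sq (hi.const_mul _), integral_const_mul,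
        integral_const_mul, horth, Finset.sum_range_succ]
      have := mul_le_mul_of_nonneg_left hX2 (sq_nonneg (α n))
      linarith
  refine hmart.submartingale.exists_ae_tendsto_of_bdd
    (R := (1 + (∑' k, α k ^ 2) * (2 * K) ^ 2).toNNReal) fun n => ?_
  rw [eLpNorm_one_eq_lintegral_enorm,
    ← ofReal_integral_norm_eq_lintegral_enorm ((hSL n).integrable one_le_two)]
  refine ENNReal.ofReal_le_ofReal ?_
  -- `|t| ≤ 1 + t²` turns the L² bound into the L¹ bound that martingale convergence requires.
  have h1 : ∫ ω, ‖Sn n ω‖ ∂P ≤ ∫ ω, (1 + Sn n ω ^ 2) ∂P := by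
    refine integral_mono ((hSL n).integrable one_le_two).norm
      ((integrable_const 1).add (hSL n).integrable_sq) fun ω => ?_
    simp only [Real.norm_eq_abs, ← sq_abs (Sn n ω)]
    nlinarith [sq_nonneg (|Sn n ω| - 1)]
  rw [integral_add (integrable_const 1) (hSL n).integrable_sq] at h1
  have h2 := hα.sum_le_tsum (Finset.range n) fun k _ => sq_nonneg _
  have h3 := hsq n
  rw [← Finset.sum_mul] at h3
  have h4 := mul_le_mul_of_nonneg_right h2 (sq_nonneg (2 * K))
  simp only [integral_const, probReal_univ, smul_eq_mul, mul_one] at h1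
  linarith

variable {X : Type*} [NormedAddCommGroup X] [InnerProductSpace ℝ X] [FiniteDimensional ℝ X]

/-- As `V k` is `ℱ k`-measurable, it can be pulled out of the conditional expectation; this reduces
to the scalar sequence `⟪V k, U k⟫`. -/
theorem ae_exists_tendsto_sum_mul_inner_sub_condExp {U V : ℕ → Ω → X} {K L : ℝ}
    (hU : ∀ k, StronglyMeasurable[ℱ (k + 1)] (U k)) (hUK : ∀ k ω, ‖U k ω‖ ≤ K)
    (hV : ∀ k, StronglyMeasurable[ℱ k] (V k)) (hVL : ∀ k ω, ‖V k ω‖ ≤ L)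
    (hα : Summable fun k => α k ^ 2) :
    ∀ᵐ ω ∂P, ∃ c, Tendsto (fun n => ∑ k ∈ Finset.range n,
      α k * inner ℝ (V k ω) (U k ω - (P[U k | ℱ k]) ω)) atTop (𝓝 c) := by
  have : CompleteSpace X := FiniteDimensional.complete ℝ X
  have hm : ∀ k, StronglyMeasurable[ℱ (k + 1)] fun ω => inner ℝ (V k ω) (U k ω) := fun k =>
    ((hV k).mono (ℱ.mono k.le_succ)).inner (hU k)
  have hb : ∀ k ω, |inner ℝ (V k ω) (U k ω)| ≤ L * K := fun k ω =>
    (abs_real_inner_le_norm _ _).trans (mul_le_mul (hVL k ω) (hUK k ω) (norm_nonneg _)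
      ((norm_nonneg _).trans (hVL k ω)))
  have hpull : ∀ᵐ ω ∂P, ∀ k, (P[fun ω => inner ℝ (V k ω) (U k ω) | ℱ k]) ω
      = inner ℝ (V k ω) ((P[U k | ℱ k]) ω) := ae_all_iff.2 fun k =>
    condExp_bilin_of_stronglyMeasurable_left (innerSL ℝ) (hV k)
      (Integrable.of_bound ((hm k).mono (ℱ.le _)).aestronglyMeasurable (L * K)
        (ae_of_all _ (hb k)))
      (Integrable.of_bound ((hU k).mono (ℱ.le _)).aestronglyMeasurable K (ae_of_all _ (hUK k)))
  filter_upwards [ae_exists_tendsto_sum_mul_sub_condExp (P := P) hm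
    (fun k => ae_of_all _ (hb k)) hα, hpull] with ω h hp
  simpa only [hp, ← inner_sub_right] using h

/-- Coordinatewise: take for `V` each constant vector of an orthonormal basis. -/
theorem ae_exists_tendsto_sum_smul_sub_condExp {U : ℕ → Ω → X} {K : ℝ}
    (hU : ∀ k, StronglyMeasurable[ℱ (k + 1)] (U k)) (hUK : ∀ k ω, ‖U k ω‖ ≤ K)
    (hα : Summable fun k => α k ^ 2) :
    ∀ᵐ ω ∂P, ∃ c, Tendsto (fun n => ∑ k ∈ Finset.range n,
      α k • (U k ω - (P[U k | ℱ k]) ω)) atTop (𝓝 c) := by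
  have : CompleteSpace X := FiniteDimensional.complete ℝ X
  let b := stdOrthonormalBasis ℝ X
  have hb := ae_all_iff.2 fun i => ae_exists_tendsto_sum_mul_inner_sub_condExp (P := P)
    (V := fun _ _ => b i) hU hUK (fun _ => stronglyMeasurable_const) (fun _ _ => le_rfl) hα
  filter_upwards [hb] with ω hω
  choose c hc using hω
  refine ⟨∑ i, c i • b i, ?_⟩
  have h := tendsto_finsetSum Finset.univ fun i _ => (hc i).smul_const (b i)
  refine h.congr fun n => ?_
  conv_rhs => rw [← b.sum_repr' (∑ k ∈ Finset.range n, α k • (U k ω - (P[U k | ℱ k]) ω))]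
  simp [inner_sum, real_inner_smul_right]

end

/-! ### Regularity of the Bellman errors and boundedness of the update. -/

namespace Model

theorem bddC11_sum_sq {Φ : Type*} [Fintype Φ] {X : Type*} [NormedAddCommGroup X]
    [NormedSpace ℝ X] {C : ℝ} {F : Φ → X → ℝ} (hF : ∀ φ, BddC11 C (F φ)) :
    BddC11 (Fintype.card Φ * (4 * C ^ 2)) fun θ => ∑ φ, F φ θ ^ 2 := by
  simpa using BddC11.sum Finset.univ fun φ _ => (hF φ).sq

variable {S A Φ : Type*} [MeasurableSpace S] [MeasurableSpace A] [MeasurableSpace Φ] {m d : ℕ}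
  {𝓜 : Model S A Φ m d}

theorem Regular.exists_bddC11 (h : 𝓜.Regular) :
    ∃ B : ℝ, 0 ≤ B ∧ ∀ j s a φ, BddC11 B (𝓜.ξ j s a φ) := by
  obtain ⟨hc, B, hB⟩ := h
  exact ⟨max B 0, le_max_right _ _, fun j s a φ =>
    (BddC11.of_contDiff_two (hc j s a φ) (fun θ => (hB j s a φ θ).1)
      (fun θ => (hB j s a φ θ).2.1) (fun θ => (hB j s a φ θ).2.2)).mono (le_max_left _ _)⟩

variable {B : ℝ} [DecidableEq Φ]

theorem bddC11_target (hξ : ∀ j s a φ, BddC11 B (𝓜.ξ j s a φ)) (j : Fin m) (a' : A) (φ : Φ)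
    (y : S × Φ) : BddC11 (1 + B) fun θ =>
      (if φ = y.2 then (1 : ℝ) else 0) + 𝓜.γ * 𝓜.ξ j y.1 a' φ θ := by
  have h0 := (hξ j y.1 a' φ).nonneg
  refine (BddC11.const ?_).add (((hξ j y.1 a' φ).const_mul 𝓜.γ).mono ?_)
  · split_ifs <;> simp
  · rw [abs_of_nonneg 𝓜.γ_nonneg]
    exact mul_le_of_le_one_left h0 𝓜.γ_lt_one.le

variable [Fintype Φ]

/-- Averaging cancels the batch size, `(1/N) * N * (1 + B)`, so the constant does not depend on `N`
and the update is bounded uniformly in the step. -/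
theorem bddC11_batchLoss (hξ : ∀ j s a φ, BddC11 B (𝓜.ξ j s a φ)) (j : Fin m) (s : S) (a : A)
    {N : ℕ} (hN : 0 < N) (K : Fin N → S × Φ) (a' : A) :
    BddC11 (Fintype.card Φ * (4 * (1 + B + B) ^ 2)) (𝓜.batchLoss j s a K a') := by
  refine bddC11_sum_sq fun φ => BddC11.sub ?_ (hξ j s a φ)
  have h := (BddC11.sum Finset.univ fun p _ =>
    bddC11_target hξ j a' φ (K p)).const_mul (1 / (N : ℝ))
  refine h.mono (le_of_eq ?_)
  have : (N : ℝ) ≠ 0 := by positivity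
  simp [abs_of_nonneg]
  field_simp

theorem exists_norm_G_le (hξ : ∀ j s a φ, BddC11 B (𝓜.ξ j s a φ)) :
    ∃ C, ∀ (Θ : JointParam m d) (s : S) (a : A) (N : ℕ) (K : Fin N → S × Φ) (i c : Fin m)
      (a' : A), 0 < N → ‖𝓜.G Θ s a K i c a'‖ ≤ C := by
  set L : ℝ := Fintype.card Φ * (4 * (1 + B + B) ^ 2)
  have hL : 0 ≤ L := by positivity
  refine ⟨√(∑ _j : Fin m, L ^ 2), fun Θ s a N K i c a' hN => ?_⟩
  rw [PiLp.norm_eq_of_L2]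
  refine Real.sqrt_le_sqrt (Finset.sum_le_sum fun j _ => ?_)
  refine pow_le_pow_left₀ (norm_nonneg _) ?_ 2
  simp only [G]
  split_ifs
  · exact (bddC11_batchLoss hξ j s a hN K a').norm_gradient_le _
  · simpa using hL

variable [MeasurableSingletonClass Φ]

theorem bddC11_bellmanLoss (hξ : ∀ j s a φ, BddC11 B (𝓜.ξ j s a φ)) (j : Fin m) (s : S)
    (a a' : A) :
    BddC11 (Fintype.card Φ * (4 * (1 + B + B) ^ 2)) (𝓜.bellmanLoss j s a a') := by
  have := 𝓜.markov
  refine bddC11_sum_sq fun φ => BddC11.sub ?_ (hξ j s a φ)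
  have h := BddC11.integral (𝓜.p (s, a)) (bddC11_target hξ j a' φ) fun θ =>
    (Measurable.ite (measurableSet_eq_fun measurable_const measurable_snd) measurable_const
      measurable_const).add (((𝓜.measurable_ξ j a' φ θ).comp measurable_fst).const_mul 𝓜.γ)
  simpa using h

/-- Since `A × A` is countable, measurability in the state for each fixed pair of actions suffices.
-/
theorem measurable_bellmanLoss [Fintype A] [MeasurableSingletonClass A] (j : Fin m) (θ : Param d) :
    Measurable fun z : S × A × A => 𝓜.bellmanLoss j z.1 z.2.1 z.2.2 θ := by
  have := 𝓜.markov
  have hm : ∀ aa : A × A, Measurable fun s => 𝓜.bellmanLoss j s aa.1 aa.2 θ := fun aa => by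
    refine Finset.measurable_sum _ fun φ _ => Measurable.pow_const (Measurable.sub ?_ ?_) 2
    · have hg : Measurable fun y : S × Φ =>
          (if φ = y.2 then (1 : ℝ) else 0) + 𝓜.γ * 𝓜.ξ j y.1 aa.2 φ θ :=
        (Measurable.ite (measurableSet_eq_fun measurable_const measurable_snd) measurable_const
          measurable_const).add (((𝓜.measurable_ξ j aa.2 φ θ).comp measurable_fst).const_mul 𝓜.γ)
      have h : Measurable fun x : S × A => ∫ y, ((if φ = y.2 then (1 : ℝ) else 0)
          + 𝓜.γ * 𝓜.ξ j y.1 aa.2 φ θ) ∂(𝓜.p x) :=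
        (StronglyMeasurable.integral_kernel_prod_right' (κ := 𝓜.p)
          (hg.comp measurable_snd).stronglyMeasurable).measurable
      exact h.comp (measurable_id.prodMk measurable_const)
    · exact 𝓜.measurable_ξ j aa.1 φ θ
  exact measurable_from_prod_countable_left hm

theorem exists_bddC11_aggregateError [Fintype A] [MeasurableSingletonClass A]
    (hξ : ∀ j s a φ, BddC11 B (𝓜.ξ j s a φ))
    (ν : Fin m → Measure (S × A × A)) [∀ j, IsFiniteMeasure (ν j)] :
    ∃ C, BddC11 C (𝓜.aggregateError ν) := by
  refine ⟨_, BddC11.sum Finset.univ fun j _ => ((BddC11.integral (ν j)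
    (fun z => bddC11_bellmanLoss hξ j z.1 z.2.1 z.2.2)
    (measurable_bellmanLoss j)).comp_clm (PiLp.proj 2 (fun _ : Fin m => Param d) j :
      JointParam m d →L[ℝ] Param d) ?_)⟩
  exact ContinuousLinearMap.opNorm_le_bound _ zero_le_one fun Θ => by
    simpa using PiLp.norm_apply_le Θ j

end Model

/-! ### Critical points, adaptedness of the update, and conclusion. -/

theorem gradient_mem_generalizedGradient {X : Type*} [NormedAddCommGroup X]
    [InnerProductSpace ℝ X] [CompleteSpace X] {f : X → ℝ} {x : X} (hf : DifferentiableAt ℝ f x) :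
    gradient f x ∈ generalizedGradient f x :=
  subset_convexHull ℝ _
    ⟨fun _ => x, tendsto_const_nhds, fun _ => hf, tendsto_const_nhds⟩

/-- Only the iterates are adapted to `ℱ`, so the update is recovered from two consecutive iterates
by dividing their difference by `α k ≠ 0`. -/
theorem Run.stronglyMeasurable_Gtilde {S A Φ : Type*} [MeasurableSpace S] [MeasurableSpace A]
    [MeasurableSpace Φ] [Fintype Φ] [DecidableEq Φ] {m d : ℕ} {𝓜 : Model S A Φ m d}
    {Ω : Type*} {mΩ : MeasurableSpace Ω} {α : ℕ → ℝ} (r : Run 𝓜 Ω α) {ℱ : Filtration ℕ mΩ}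
    (hΘ : ∀ k, Measurable[ℱ k] (r.Θ k)) (hα : ∀ k, 0 < α k) (k : ℕ) :
    StronglyMeasurable[ℱ (k + 1)] (r.Gtilde k) := by
  have h : r.Gtilde k = fun ω => (α k)⁻¹ • (r.Θ k ω - r.Θ (k + 1) ω) := by
    ext1 ω
    rw [r.update k ω, sub_sub_cancel, inv_smul_smul₀ (hα k).ne']
    rfl
  rw [h]
  exact ((((hΘ k).mono (ℱ.mono k.le_succ) le_rfl).sub (hΘ (k + 1))).const_smul
    (α k)⁻¹).stronglyMeasurable

end FGSFRQL

theorem mainTheorem1 {S A Φ : Type*} [MeasurableSpace S]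
    [Fintype A] [MeasurableSpace A] [MeasurableSingletonClass A]
    [Fintype Φ] [DecidableEq Φ] [MeasurableSpace Φ] [MeasurableSingletonClass Φ]
    {m d : ℕ} (𝓜 : FGSFRQL.Model S A Φ m d)
    (ν : Fin m → Measure (S × A × A)) [∀ j, IsFiniteMeasure (ν j)]
    {Ω : Type*} [mΩ : MeasurableSpace Ω] (P : Measure Ω) [IsProbabilityMeasure P]
    (α : ℕ → ℝ) (r : FGSFRQL.Run 𝓜 Ω α)
    (ℱ : Filtration ℕ mΩ) (hΘ : ∀ k, Measurable[ℱ k] (r.Θ k))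
    -- properties of the system
    (hreg : 𝓜.Regular)
    (hties : 𝓜.TiesNull)
    (hcrit : {Θ | (0 : FGSFRQL.JointParam m d) ∈
      FGSFRQL.generalizedGradient (𝓜.aggregateError ν) Θ}.Finite)
    -- stability of the iterates
    (hbdd : ∀ᵐ ω ∂P, ∃ B : ℝ, ∀ k, ‖r.Θ k ω‖ ≤ B)
    -- decomposition of the stochastic error
    (hnoise : ∃ C : ℝ, 0 < C ∧ ∀ k,
      P[fun ω => ‖r.noise P ℱ k ω‖ ^ 2 | ℱ k] ≤ᵐ[P] fun ω => C * (1 + ‖r.Θ k ω‖ ^ 2))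
    (hbias : ∀ᵐ ω ∂P, Tendsto (fun k => ‖r.bias P ℱ ν k ω‖) atTop (𝓝 0))
    (hbias_sum : Summable fun k => α k * ∫ ω, ‖r.bias P ℱ ν k ω‖ ∂P)
    -- step sizes and visitation
    (hα_pos : ∀ k, 0 < α k) (hα_sum : ¬ Summable α) (hα_sq : Summable fun k => α k ^ 2)
    (hvisit : ∀ᵐ ω ∂P, ∀ j : Fin m, ∃ᶠ k in atTop, j = r.task k ω ∨ j = (r.gpi k ω).1) :
    ∀ᵐ ω ∂P, ∃ Θstar : FGSFRQL.JointParam m d,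
      Tendsto (fun k => r.Θ k ω) atTop (𝓝 Θstar) ∧
      HasGradientAt (𝓜.aggregateError ν) 0 Θstar := by
  obtain ⟨B, -, hξ⟩ := hreg.exists_bddC11
  obtain ⟨K, hE⟩ := FGSFRQL.Model.exists_bddC11_aggregateError hξ ν
  obtain ⟨C, hC⟩ := FGSFRQL.Model.exists_norm_G_le hξ
  have hU : ∀ k ω, ‖r.Gtilde k ω‖ ≤ C := fun k ω => hC _ _ _ _ _ _ _ _ (r.N_pos k)
  have hUm := r.stronglyMeasurable_Gtilde hΘ hα_pos
  have hgm : ∀ k, StronglyMeasurable[ℱ k]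
      fun ω => gradient (𝓜.aggregateError ν) (r.Θ k ω) := fun k =>
    (hE.continuous_gradient.measurable.comp (hΘ k)).stronglyMeasurable
  have hgi : ∀ k, Integrable (fun ω => gradient (𝓜.aggregateError ν) (r.Θ k ω)) P := fun k =>
    Integrable.of_bound ((hgm k).mono (ℱ.le k)).aestronglyMeasurable K
      (ae_of_all _ fun ω => hE.norm_gradient_le _)
  have hbsum : ∀ᵐ ω ∂P, Summable fun k => α k * ‖r.bias P ℱ ν k ω‖ :=
    FGSFRQL.ae_summable_of_summable_integral
      (fun k => ((integrable_condExp.sub (hgi k)).norm.const_mul (α k)))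
      (fun k ω => mul_nonneg (hα_pos k).le (norm_nonneg _))
      (by simpa only [integral_const_mul] using hbias_sum)
  -- At each zero of the gradient, `0` belongs to the generalized gradient, so the finiteness of
  -- Clarke critical points carries over.
  have hfin : {z | gradient (𝓜.aggregateError ν) z = 0}.Finite :=
    hcrit.subset fun z hz => by
      have h := FGSFRQL.gradient_mem_generalizedGradient (hE.differentiable z)
      rw [show gradient (𝓜.aggregateError ν) z = 0 from hz] at h
      exact h
  filter_upwards [hbdd, hbsum, FGSFRQL.ae_exists_tendsto_sum_smul_sub_condExp (P := P) hUm hU hα_sq,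
    FGSFRQL.ae_exists_tendsto_sum_mul_inner_sub_condExp (P := P) hUm hU hgm
      (fun k ω => hE.norm_gradient_le _) hα_sq] with ω ⟨R, hR⟩ hb hM hMi
  obtain ⟨z, hz, hlim⟩ := FGSFRQL.exists_tendsto_of_perturbed_gradient hE hfin
    (x := fun k => r.Θ k ω) (u := fun k => r.Gtilde k ω) (M := fun k => r.noise P ℱ k ω)
    (e := fun k => r.bias P ℱ ν k ω) (fun k => hU k ω) (fun k => r.update k ω)
    (fun k => by simp only [FGSFRQL.Run.noise, FGSFRQL.Run.bias]; abel) hR hα_pos hα_sum hα_sq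
    hM hMi hb
  exact ⟨z, hlim, hz ▸ (hE.differentiable z).hasGradientAt⟩
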